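/- Let $L$ be a first-order language and let $\mathcal U$ be a saturated $L$-structure whose cardinality $\kappa=|\mathcal U|$ is an (uncountable, strongly) inaccessible cardinal larger than $|L|$. Let $n<\omega$ and let $\mathcal D\subseteq\mathcal U^{n}$ be an arbitrary set. A model is an elementary substructure of $\mathcal U$ of cardinality $<\kappa$. For $B\subseteq\mathcal U$ with $|B|<\kappa$ and $\mathcal C\subseteq\mathcal U^n$, let $o(\mathcal C/B)=\{f[\mathcal C] : f\in\mathrm{Aut}(\mathcal U/B)\}$ be the orbit of $\mathcal C$ under the automorphisms of $\mathcal U$ that fix $B$ pointwise. We say that $\mathcal C$ is invariant over $B$, or $B$-invariant, if $o(\mathcal C/B)=\{\mathcal C\}$, and that $\mathcal C$ is Lascar invariant over $B$ if it is invariant over every model $N\supseteq B$. Let $L(B)$ be the set of first-order formulas with parameters from $B$, and let $L(B;\mathcal C)$ be the set of first-order formulas with parameters from $B$ in the language $L$ expanded by an $n$-ary predicate interpreted as $\mathcal C$. A sequence $\langle a_i : i\in I\rangle$ of finite tuples of $\mathcal U$, all of the same length, indexed by a linear order $I$ is indiscernible in a set of formulas $\Delta$ if $\varphi(a_{i_1},\dots,a_{i_k})\leftrightarrow\varphi(a_{j_1},\dots,a_{j_k})$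 for every $k$, every $i_1<\dots<i_k$ and $j_1<\dots<j_k$ in $I$, and every $\varphi(x_1,\dots,x_k)\in\Delta$. It is $B$-indiscernible if it is indiscernible in $L(B)$, and it is endless if $I$ has no last element. Then, for every model $M$ and every $A\subseteq M$, the following are equivalent: 1. $\mathcal D$ is Lascar invariant over $A$; 2. every set in $o(\mathcal D/A)$ is $M$-invariant; 3. $|o(\mathcal D/A)|<\kappa$; 4. every endless $A$-indiscernible sequence (of finite tuples of any length) is indiscernible in $L(A;\mathcal D)$; 5. $c_0\in\mathcal D\leftrightarrow c_1\in\mathcal D$ for every $A$-indiscernible sequence $c=\langle c_i : i<\omega\rangle$ of elements of $\mathcal U^{n}$. -/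

import Mathlib

open FirstOrder
open scoped Cardinal

universe u v w x

namespace LascarInvariance

/-- The structure `U` is saturated: every set of formulas in one free variable, with parameters
in a set `A ⊆ U` of cardinality less than `|U|`, that is finitely satisfiable in `U` is realized
in `U`. -/
def IsSaturated (L : FirstOrder.Language.{u, v}) (U : Type w) [L.Structure U] : Prop :=
  ∀ A : Set U, #A < #U → ∀ p : Set (L[[A]].Formula Unit),
    (∀ q : Finset (L[[A]].Formula Unit), (q : Set (L[[A]].Formula Unit)) ⊆ p →
      ∃ b : U, ∀ φ ∈ q, φ.Realize (fun _ => b)) →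
    ∃ b : U, ∀ φ ∈ p, φ.Realize (fun _ => b)

/-- The orbit `o(D/A)` of `D ⊆ U ^ n` under the group of automorphisms of `U` that fix `A`
pointwise. -/
def orbit (L : FirstOrder.Language.{u, v}) {U : Type w} [L.Structure U] {n : ℕ}
    (A : Set U) (D : Set (Fin n → U)) : Set (Set (Fin n → U)) :=
  {C | ∃ f : U ≃[L] U, (∀ a ∈ A, f a = a) ∧ (fun c : Fin n → U => f ∘ c) '' D = C}

/-- `D` is invariant over `A` (or `A`-invariant): `o(D/A) = {D}`. -/
def IsInvariant (L : FirstOrder.Language.{u, v}) {U : Type w} [L.Structure U] {n : ℕ}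
    (A : Set U) (D : Set (Fin n → U)) : Prop :=
  orbit L A D = {D}

/-- `D` is Lascar invariant over `A`: it is invariant over every model that contains `A`, where a
model is an elementary substructure of `U` of cardinality less than `|U|`. -/
def IsLascarInvariant (L : FirstOrder.Language.{u, v}) {U : Type w} [L.Structure U] {n : ℕ}
    (A : Set U) (D : Set (Fin n → U)) : Prop :=
  ∀ M : L.ElementarySubstructure U, #M < #U → A ⊆ (M : Set U) → IsInvariant L (M : Set U) D

/-- The relation symbols of the language with a single `n`-ary predicate. -/
inductive PredicateSymbol (n : ℕ) : ℕ → Type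
  | mem : PredicateSymbol n n

/-- The language with a single `n`-ary predicate and no other symbols. -/
abbrev predicateLanguage (n : ℕ) : FirstOrder.Language.{0, 0} :=
  ⟨fun _ => Empty, PredicateSymbol n⟩

/-- The interpretation of the `n`-ary predicate as membership in `D`. -/
@[reducible]
def predicateStructure {U : Type w} {n : ℕ} (D : Set (Fin n → U)) :
    (predicateLanguage n).Structure U where
  funMap := fun f _ => Empty.elim f
  RelMap := fun r => match r with
    | PredicateSymbol.mem => fun c => c ∈ D

/-- A sequence of `m`-tuples of `U`, indexed by a linear order `I`, is indiscernible with respect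
to all formulas of the language `L`. -/
def IsIndiscernible (L : FirstOrder.Language.{u, v}) {U : Type w} [L.Structure U] {m : ℕ}
    {I : Type x} [LinearOrder I] (c : I → Fin m → U) : Prop :=
  ∀ (k : ℕ) (i j : Fin k → I), StrictMono i → StrictMono j →
    ∀ φ : L.Formula (Fin k × Fin m),
      φ.Realize (fun p => c (i p.1) p.2) ↔ φ.Realize (fun p => c (j p.1) p.2)

/-- `A`-indiscernible sequences: indiscernible in `L(A)`. -/
def IsIndiscernibleOver (L : FirstOrder.Language.{u, v}) {U : Type w} [L.Structure U] (A : Set U) {m : ℕ}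
    {I : Type x} [LinearOrder I] (c : I → Fin m → U) : Prop :=
  IsIndiscernible (L[[A]]) c

/-- Sequences indiscernible in `L(A; D)`, the first-order formulas of `L` with parameters in `A`
and a new predicate for `D`. -/
def IsIndiscernibleOverWith (L : FirstOrder.Language.{u, v}) {U : Type w} [L.Structure U] (A : Set U)
    {n : ℕ} (D : Set (Fin n → U)) {m : ℕ}
    {I : Type x} [LinearOrder I] (c : I → Fin m → U) : Prop :=
  letI := predicateStructure D
  IsIndiscernible ((L[[A]]).sum (predicateLanguage n)) c

end LascarInvariance

/-!
A set that is invariant over a small set `B` is determined by the types over `B` of its elements,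
since in a saturated structure tuples with the same type over `B` are conjugate over `B`. A strong
limit `κ` leaves fewer than `κ` sets of types, so there are fewer than `κ` such sets.

If `o(D/A)` is small and `c` is `A`-indiscernible, the type over `A` of two consecutive blocks of
`c` is that of all increasing pairs of a sequence of length `κ`. By the pigeonhole principle some
pair `e s`, `e t` with `s < t` satisfies the same instances of a given formula, whichever set of the
orbit interprets the predicate. An automorphism over `A` carries the two blocks to this pair and `D`
to a set of the orbit, so the formula with predicate `D` does not separate the blocks. Any two
blocks of an endless sequence lie below a third one.

Tuples with the same type over a model `N` realize over `N` the average type of one ultrafilter on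
the tuples of `N`. Realizing the same average over larger and larger sets prolongs both of them to
`N`-indiscernible sequences with a common second term, and this makes a set that is constant on
indiscernible sequences invariant over `N`.
-/

namespace LascarInvariance

open FirstOrder.Language Set Filter

/-! ### Transfinite recursion for properties of finite character -/

section FiniteCharacter

theorem exists_forall_image_Iio {T X : Type*} [Preorder T] [WellFoundedLT T] [Nonempty X]
    (Q : T → Set X → X → Prop) :
    ∃ f : T → X, ∀ t, (∃ x, Q t (f '' Iio t) x) → Q t (f '' Iio t) (f t) := by
  let f : T → X := wellFounded_lt.fix fun t f =>
    Classical.epsilon (Q t (range fun s : Iio t => f s s.2))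
  have hf (t : T) : f t = Classical.epsilon (Q t (f '' Iio t)) := by
    rw [image_eq_range]
    exact wellFounded_lt.fix_eq _ t
  exact ⟨f, fun t h => hf t ▸ Classical.epsilon_spec h⟩

variable {X : Type u} {P : Set (Set X)}

theorem union_image_mem_of_isOfFiniteCharacter (hP : Order.IsOfFiniteCharacter P) {S : Set X}
    (hS : S ∈ P) {T : Type*} [LinearOrder T] {f : T → X} {J : Set T}
    (hJ : ∀ t ∈ J, S ∪ f '' Iic t ∈ P) : S ∪ f '' J ∈ P := by
  rcases J.eq_empty_or_nonempty with rfl | hne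
  · simpa using hS
  refine (hP _).2 fun F hF hfin => ?_
  have hcover : F ⊆ ⋃ t ∈ J, (S ∪ f '' Iic t) := fun x hx => by
    rcases hF hx with hx | ⟨t, ht, rfl⟩
    · exact mem_biUnion hne.some_mem (Or.inl hx)
    · exact mem_biUnion ht (Or.inr ⟨t, le_rfl, rfl⟩)
  have hmono : Monotone fun t => S ∪ f '' Iic t := fun s t hst =>
    union_subset_union_right S (image_mono (Iic_subset_Iic.2 hst))
  lift F to Finset X using hfin
  obtain ⟨t, ht, hFt⟩ := DirectedOn.exists_mem_subset_of_finset_subset_biUnion hne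
    (fun s hs t ht => ⟨max s t, by rcases max_choice s t with h | h <;> rwa [h],
      hmono (le_max_left s t), hmono (le_max_right s t)⟩) hcover
  exact (hP _).1 (hJ t ht) _ hFt F.finite_toSet

theorem exists_superset_of_isOfFiniteCharacter (hP : Order.IsOfFiniteCharacter P) {S : Set X}
    (hS : S ∈ P) {T : Type v} (task : T → X → Prop)
    (hstep : ∀ t (R : Set X), Cardinal.lift.{v} #R < Cardinal.lift.{u} #T → S ∪ R ∈ P →
      ∃ x, task t x ∧ insert x (S ∪ R) ∈ P) :
    ∃ S' ∈ P, S ⊆ S' ∧ ∀ t, ∃ x ∈ S', task t x := by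
  rcases isEmpty_or_nonempty T with _ | ⟨⟨t₀⟩⟩
  · exact ⟨S, hS, subset_rfl, isEmptyElim⟩
  obtain ⟨x₀, -⟩ := hstep t₀ ∅ (by simp [pos_iff_ne_zero, Cardinal.mk_ne_zero_iff.2 ⟨t₀⟩])
    (by simpa using hS)
  have : Nonempty X := ⟨x₀⟩
  obtain ⟨_, _, hord⟩ := Cardinal.exists_ord_eq_type_lt T
  obtain ⟨f, hf⟩ := exists_forall_image_Iio fun t R x => task t x ∧ insert x (S ∪ R) ∈ P
  have hstep' (t : T) (ht : S ∪ f '' Iio t ∈ P) :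
      task t (f t) ∧ insert (f t) (S ∪ f '' Iio t) ∈ P :=
    hf t (hstep t _ (Cardinal.mk_image_le_lift.trans_lt
      (Cardinal.lift_lt.2 (Cardinal.mk_Iio_lt t hord))) ht)
  have hIic (t : T) (ht : S ∪ f '' Iio t ∈ P) : S ∪ f '' Iic t ∈ P := by
    rw [← Iio_insert, image_insert_eq, union_insert]
    exact (hstep' t ht).2
  have hIio (t : T) : S ∪ f '' Iio t ∈ P := by
    induction t using WellFoundedLT.induction with
    | ind t ih => exact union_image_mem_of_isOfFiniteCharacter hP hS fun s hs => hIic s (ih s hs)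
  exact ⟨S ∪ range f, image_univ ▸
    union_image_mem_of_isOfFiniteCharacter hP hS fun t _ => hIic t (hIio t),
    subset_union_left, fun t => ⟨f t, Or.inr ⟨t, rfl⟩, (hstep' t (hIio t)).1⟩⟩

end FiniteCharacter

/-! ### Tuples of the same type -/

section SameType

/-- The tuples `a` and `b` have the same type: they satisfy the same formulas of `L`. They may lie
in different structures. For tuples of one structure, `SameType L[[A]] a b` says that they have the
same type over the set `A`. -/
def SameType (L : FirstOrder.Language.{u, v}) {V U : Type*} [L.Structure V] [L.Structure U]
    {α : Type*} (a : α → V) (b : α → U) : Prop :=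
  ∀ φ : L.Formula α, φ.Realize a ↔ φ.Realize b

variable {L : FirstOrder.Language.{u, v}} {V U : Type*} [L.Structure V] [L.Structure U]
  {α β : Type*} {a : α → V} {b : α → U}

theorem SameType.symm (h : SameType L a b) : SameType L b a :=
  fun φ => (h φ).symm

theorem SameType.comp (h : SameType L a b) (f : β → α) : SameType L (a ∘ f) (b ∘ f) := fun φ => by
  simpa only [Formula.realize_relabel] using h (φ.relabel f)

theorem SameType.of_imp (h : ∀ φ : L.Formula α, φ.Realize a → φ.Realize b) : SameType L a b :=
  fun φ => ⟨h φ, fun hb => by_contra fun ha => h φ.not ha hb⟩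

theorem sameType_of_forall_finite
    (h : ∀ F : Set α, F.Finite → SameType L (a ∘ ((↑) : F → α)) (b ∘ ((↑) : F → α))) :
    SameType L a b := fun φ => by
  classical
  have hφ := h φ.freeVarFinset φ.freeVarFinset.finite_toSet
    (BoundedFormula.restrictFreeVar φ (inclusion subset_rfl))
  rwa [Formula.Realize, Formula.Realize, BoundedFormula.realize_restrictFreeVar',
    BoundedFormula.realize_restrictFreeVar'] at hφ

theorem realize_constantsVarsEquiv {A : Set U} (φ : L[[A]].Formula α) (b : α → U) :
    Formula.Realize (BoundedFormula.constantsVarsEquiv φ : L.Formula (A ⊕ α))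
      (Sum.elim (↑) b) ↔ φ.Realize b :=
  BoundedFormula.realize_constantsVarsEquiv

theorem exists_formula_withConstants_realize_iff {B : Set U} {d : β → U} (hd : ∀ i, d i ∈ B)
    (φ : L.Formula (β ⊕ α)) :
    ∃ ψ : L[[B]].Formula α, ∀ b : α → U, ψ.Realize b ↔ φ.Realize (Sum.elim d b) := by
  refine ⟨BoundedFormula.constantsVarsEquiv.symm
    (φ.relabel (Sum.map (fun i => ⟨d i, hd i⟩) id) : L.Formula (B ⊕ α)), fun b => ?_⟩
  rw [← realize_constantsVarsEquiv, Equiv.apply_symm_apply, Formula.realize_relabel,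
    Sum.elim_comp_map]
  rfl

theorem sameType_withConstants_iff {A : Set U} {a b : α → U} :
    SameType L[[A]] a b ↔
      SameType L (Sum.elim ((↑) : A → U) a) (Sum.elim ((↑) : A → U) b) := by
  refine BoundedFormula.constantsVarsEquiv.forall_congr fun {φ} => ?_
  exact iff_congr (realize_constantsVarsEquiv φ a).symm (realize_constantsVarsEquiv φ b).symm

theorem SameType.withConstants_mono {A B : Set U} (hAB : A ⊆ B) {a b : α → U}
    (h : SameType L[[B]] a b) : SameType L[[A]] a b := fun φ => by
  simpa only [LHom.realize_onFormula] using h ((L.lhomWithConstantsMap (inclusion hAB)).onFormula φ)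

end SameType

/-! ### Partial elementary maps -/

section PartialElementary

/-- A relation between two structures is partial elementary if enumerating its pairs gives two
tuples of the same type. Since equality is a formula, such a relation is the graph of an injective
partial map. -/
def IsPartialElementary (L : FirstOrder.Language.{u, v}) {V U : Type*} [L.Structure V]
    [L.Structure U] (S : Set (V × U)) : Prop :=
  SameType L (fun s : S => s.1.1) fun s : S => s.1.2

variable {L : FirstOrder.Language.{u, v}} {V U : Type*} [L.Structure V] [L.Structure U]
  {S : Set (V × U)} {α : Type*}

theorem IsPartialElementary.sameType (hS : IsPartialElementary L S) {s : α → V × U}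
    (hs : ∀ i, s i ∈ S) : SameType L (fun i => (s i).1) fun i => (s i).2 :=
  SameType.comp hS fun i => ⟨s i, hs i⟩

theorem SameType.isPartialElementary {a : α → V} {b : α → U} (h : SameType L a b)
    (hS : S ⊆ range fun i => (a i, b i)) : IsPartialElementary L S := by
  choose r hr using fun s : S => hS s.2
  simpa only [Function.comp_def, IsPartialElementary, ← hr] using h.comp r

theorem IsPartialElementary.swap (hS : IsPartialElementary L S) :
    IsPartialElementary L (Prod.swap '' S) :=
  SameType.symm hS |>.isPartialElementary (image_subset_iff.2 fun s hs => ⟨⟨s, hs⟩, rfl⟩)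

theorem isOfFiniteCharacter_isPartialElementary :
    Order.IsOfFiniteCharacter {S : Set (V × U) | IsPartialElementary L S} := by
  refine fun S => ⟨fun hS F hF _ => hS.sameType fun s : F => hF s.2, fun h => ?_⟩
  refine sameType_of_forall_finite fun F hF => ?_
  exact (h ((↑) '' F) (Subtype.coe_image_subset S F) (hF.image _)).sameType
    fun s : F => mem_image_of_mem _ s.2

theorem IsPartialElementary.fst_eq_iff_snd_eq (hS : IsPartialElementary L S) {s t : V × U}
    (hs : s ∈ S) (ht : t ∈ S) : s.1 = t.1 ↔ s.2 = t.2 := by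
  have := hS.sameType (s := ![s, t]) (by simp [Fin.forall_fin_two, hs, ht])
    ((Term.var 0).equal (Term.var 1))
  simpa [Formula.realize_equal] using this

theorem IsPartialElementary.exists_equiv (hS : IsPartialElementary L S)
    (hfst : ∀ y, ∃ s ∈ S, s.1 = y) (hsnd : ∀ z, ∃ s ∈ S, s.2 = z) :
    ∃ f : V ≃[L] U, ∀ s ∈ S, f s.1 = s.2 := by
  choose p hpS hp using hfst
  choose q hqS hq using hsnd
  have hleft (y : V) : (q (p y).2).1 = y := by
    rw [(hS.fst_eq_iff_snd_eq (hqS _) (hpS y)).2 (hq _), hp]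
  have hright (z : U) : (p (q z).1).2 = z := by
    rw [(hS.fst_eq_iff_snd_eq (hpS _) (hqS z)).1 (hp _), hq]
  let F : V ↪ₑ[L] U := ⟨fun y => (p y).2, fun k φ e => by
    simpa only [Function.comp_def, hp] using (hS.sameType (fun i => hpS (e i)) φ).symm⟩
  refine ⟨⟨⟨fun y => (p y).2, fun z => (q z).1, hleft, hright⟩, F.map_fun, F.map_rel⟩, ?_⟩
  exact fun s hs => (hS.fst_eq_iff_snd_eq (hpS _) hs).1 (hp _)

end PartialElementary

/-! ### Saturated structures -/

section Saturated

theorem mk_image_union_lt {X Y : Type u} {κ : Cardinal.{u}} (hκ : ℵ₀ ≤ κ) {f : X → Y}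
    {S R : Set X} (hS : #(f '' S) < κ) (hR : #R < κ) : #(f '' (S ∪ R)) < κ := by
  rw [image_union]
  exact (Cardinal.mk_union_le _ _).trans_lt (Cardinal.add_lt_of_lt hκ hS
    (Cardinal.mk_image_le.trans_lt hR))

theorem mk_union_lt_of_finite {X : Type u} {κ : Cardinal.{u}} (hκ : ℵ₀ ≤ κ) {S T : Set X}
    (hS : #S < κ) (hT : T.Finite) : #(S ∪ T : Set X) < κ :=
  (Cardinal.mk_union_le _ _).trans_lt (Cardinal.add_lt_of_lt hκ hS
    ((Cardinal.lt_aleph0_iff_set_finite.2 hT).trans_le hκ))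

variable {L : FirstOrder.Language.{u, v}} {V U : Type w} [L.Structure V] [L.Structure U]

theorem IsSaturated.exists_realize (hU : IsSaturated L U) {α : Type*} (b : α → U)
    (hb : #(range b) < #U) (p : Set (L.Formula (α ⊕ Unit)))
    (hp : ∀ q : Finset (L.Formula (α ⊕ Unit)), (q : Set _) ⊆ p →
      ∃ z : U, ∀ φ ∈ q, φ.Realize (Sum.elim b fun _ => z)) :
    ∃ z : U, ∀ φ ∈ p, φ.Realize (Sum.elim b fun _ => z) := by
  classical
  choose F hF using
    exists_formula_withConstants_realize_iff (L := L) (α := Unit) (mem_range_self (f := b))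
  simp only [← hF] at hp ⊢
  simpa only [forall_mem_image] using hU (range b) hb (F '' p) fun q hq => by
    obtain ⟨q, hqp, rfl⟩ := Finset.subset_set_image_iff.1 hq
    simpa only [Finset.forall_mem_image] using hp q hqp

theorem IsSaturated.exists_sameType_sumElim_unit (hU : IsSaturated L U) {α : Type*} {a : α → V}
    {b : α → U} (h : SameType L a b) (hb : #(range b) < #U) (y : V) :
    ∃ z : U, SameType L (Sum.elim a fun _ : Unit => y) (Sum.elim b fun _ => z) := by
  obtain ⟨z, hz⟩ := hU.exists_realize b hb {φ | φ.Realize (Sum.elim a fun _ => y)} fun q hq => by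
    have hex := h ((Formula.iInf fun φ : q => φ.1).iExs Unit)
    simp only [Formula.realize_iExs, Formula.realize_iInf] at hex
    obtain ⟨z, hz⟩ := hex.1 ⟨fun _ => y, fun φ => hq φ.2⟩
    exact ⟨z (), fun φ hφ => hz ⟨φ, hφ⟩⟩
  exact ⟨z, SameType.of_imp hz⟩

theorem IsPartialElementary.exists_insert {S : Set (V × U)} (hS : IsPartialElementary L S)
    (hU : IsSaturated L U) (hc : #(Prod.snd '' S) < #U) (y : V) :
    ∃ z : U, IsPartialElementary L (insert (y, z) S) := by
  obtain ⟨z, hz⟩ := hU.exists_sameType_sumElim_unit hS (by rwa [← image_eq_range]) y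
  refine ⟨z, hz.isPartialElementary (insert_subset ⟨Sum.inr (), rfl⟩ fun s hs => ?_)⟩
  exact ⟨Sum.inl ⟨s, hs⟩, rfl⟩

theorem IsSaturated.exists_sameType_sumElim (hU : IsSaturated L U) (hκ : ℵ₀ ≤ #U) {α : Type*}
    {ι : Type x} {a : α → V} {b : α → U} (h : SameType L a b) (hb : #(range b) < #U)
    (hι : Cardinal.lift.{w} #ι ≤ Cardinal.lift #U) (y : ι → V) :
    ∃ z : ι → U, SameType L (Sum.elim a y) (Sum.elim b z) := by
  have hb' : #(Prod.snd '' range fun i => (a i, b i)) < #U := by rwa [← range_comp]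
  obtain ⟨S, hS, habS, hyS⟩ := exists_superset_of_isOfFiniteCharacter
    isOfFiniteCharacter_isPartialElementary (h.isPartialElementary subset_rfl)
    (fun (i : ι) s => s.1 = y i) fun i R hR hSR => by
      have hR' : #R < #U := Cardinal.lift_lt.1 (hR.trans_le hι)
      obtain ⟨z, hz⟩ := IsPartialElementary.exists_insert hSR hU
        (mk_image_union_lt hκ hb' hR') (y i)
      exact ⟨(y i, z), rfl, hz⟩
  choose s hsS hs using hyS
  refine ⟨fun i => (s i).2, ?_⟩
  have := hS.sameType (s := Sum.elim (fun i => (a i, b i)) s) fun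
    | Sum.inl i => habS ⟨i, rfl⟩
    | Sum.inr i => hsS i
  convert this using 1 <;> ext (i | i) <;> simp [hs]

theorem IsSaturated.exists_equiv (hV : IsSaturated L V) (hU : IsSaturated L U) (hVU : #V = #U)
    (hκ : ℵ₀ ≤ #U) {α : Type*} {a : α → V} {b : α → U} (h : SameType L a b)
    (ha : #(range a) < #V) (hb : #(range b) < #U) : ∃ f : V ≃[L] U, ∀ i, f (a i) = b i := by
  have ha' : #(Prod.fst '' range fun i => (a i, b i)) < #V := by rwa [← range_comp]
  have hb' : #(Prod.snd '' range fun i => (a i, b i)) < #U := by rwa [← range_comp]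
  obtain ⟨S, hS, habS, hS'⟩ := exists_superset_of_isOfFiniteCharacter
    isOfFiniteCharacter_isPartialElementary (h.isPartialElementary subset_rfl)
    (Sum.elim (fun y s => s.1 = y) fun z s => s.2 = z : V ⊕ U → V × U → Prop)
    fun t R hR hSR => by
      have hR' : #R < #U := by simpa [hVU, Cardinal.add_eq_self hκ] using hR
      rcases t with y | z
      · obtain ⟨z, hz⟩ := IsPartialElementary.exists_insert hSR hU
          (mk_image_union_lt hκ hb' hR') y
        exact ⟨(y, z), rfl, hz⟩
      · obtain ⟨y, hy⟩ := IsPartialElementary.exists_insert (IsPartialElementary.swap hSR) hV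
          (by
            simp only [image_image, Prod.snd_swap]
            exact mk_image_union_lt (hκ.trans_eq hVU.symm) ha' (hR'.trans_eq hVU.symm)) z
        refine ⟨(y, z), rfl, show IsPartialElementary L _ from ?_⟩
        simpa only [image_insert_eq, image_image, Prod.swap_swap, image_id', Prod.swap_prod_mk]
          using hy.swap
  obtain ⟨f, hf⟩ := IsPartialElementary.exists_equiv hS (fun y => hS' (Sum.inl y)) fun z =>
    hS' (Sum.inr z)
  exact ⟨f, fun i => hf _ (habS ⟨i, rfl⟩)⟩

theorem IsSaturated.exists_equiv_fixing (hU : IsSaturated L U) (hκ : ℵ₀ ≤ #U) {A : Set U}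
    (hA : #A < #U) {ι : Type*} [Finite ι] {a b : ι → U} (h : SameType L[[A]] a b) :
    ∃ f : U ≃[L] U, (∀ x ∈ A, f x = x) ∧ f ∘ a = b := by
  have hr (c : ι → U) : #(range (Sum.elim ((↑) : A → U) c)) < #U := by
    rw [Sum.elim_range, Subtype.range_coe]
    exact mk_union_lt_of_finite hκ hA (finite_range c)
  obtain ⟨f, hf⟩ := hU.exists_equiv hU rfl hκ (sameType_withConstants_iff.1 h) (hr a) (hr b)
  exact ⟨f, fun x hx => hf (Sum.inl ⟨x, hx⟩), funext fun i => hf (Sum.inr i)⟩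

end Saturated

/-! ### Average types -/

section Average

variable {L : FirstOrder.Language.{u, v}} {U : Type w} [L.Structure U]

/-- The tuple `c` realizes over `B` the average type of the family `e` of tuples along the
ultrafilter `𝒱`: the global type that consists of the formulas satisfied by `𝒱`-almost all of these
tuples. If the tuples `e y` lie in a set `N` then this type is finitely satisfiable in `N`. -/
def RealizesAverage (L : FirstOrder.Language.{u, v}) {U : Type w} [L.Structure U] {Y ι : Type*}
    (𝒱 : Ultrafilter Y) (e : Y → ι → U) (B : Set U) (c : ι → U) : Prop :=
  ∀ φ : L[[B]].Formula ι, φ.Realize c ↔ ∀ᶠ y in 𝒱, φ.Realize (e y)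

variable {Y ι β : Type*} {𝒱 : Ultrafilter Y} {e : Y → ι → U} {B : Set U} {c : ι → U}

theorem realizesAverage_iff : RealizesAverage L 𝒱 e B c ↔ ∀ φ : L.Formula (B ⊕ ι),
    φ.Realize (Sum.elim (↑) c) ↔ ∀ᶠ y in 𝒱, φ.Realize (Sum.elim (↑) (e y)) := by
  refine BoundedFormula.constantsVarsEquiv.forall_congr fun {φ} => ?_
  simp only [← realize_constantsVarsEquiv]

theorem RealizesAverage.realize_iff (h : RealizesAverage L 𝒱 e B c) {d : β → U}
    (hd : ∀ i, d i ∈ B) (φ : L.Formula (β ⊕ ι)) :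
    φ.Realize (Sum.elim d c) ↔ ∀ᶠ y in 𝒱, φ.Realize (Sum.elim d (e y)) := by
  obtain ⟨ψ, hψ⟩ := exists_formula_withConstants_realize_iff (α := ι) hd φ
  simpa only [hψ] using h ψ

theorem RealizesAverage.mono {A : Set U} (hAB : A ⊆ B) (h : RealizesAverage L 𝒱 e B c) :
    RealizesAverage L 𝒱 e A c :=
  realizesAverage_iff.2 (h.realize_iff fun a => hAB a.2)

theorem IsSaturated.exists_realizesAverage (hU : IsSaturated L U) (hκ : ℵ₀ ≤ #U)
    (hB : #B < #U) (hι : Cardinal.lift.{w} #ι ≤ Cardinal.lift #U) {Y : Type w}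
    (𝒱 : Ultrafilter Y) (e : Y → ι → U) : ∃ c, RealizesAverage L 𝒱 e B c := by
  -- The ultrapower realizes the average type, and saturation pulls the realization back to `U`.
  let V := (𝒱 : Filter Y).Product fun _ => U
  have : Nonempty U := Cardinal.mk_ne_zero_iff.1 (Cardinal.aleph0_pos.trans_le hκ).ne'
  let g : B ⊕ ι → V := fun i => ((fun y => Sum.elim (↑) (e y) i : Y → U) : V)
  have hlos (φ : L.Formula (B ⊕ ι)) :
      φ.Realize g ↔ ∀ᶠ y in 𝒱, φ.Realize (Sum.elim (↑) (e y)) :=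
    Ultraproduct.realize_formula_cast φ fun i y => Sum.elim (↑) (e y) i
  have hdiag : SameType L (g ∘ Sum.inl) ((↑) : B → U) := fun φ =>
    (Ultraproduct.realize_formula_cast φ fun b _ => (b : U)).trans eventually_const
  obtain ⟨c, hc⟩ :=
    hU.exists_sameType_sumElim hκ hdiag (by rwa [Subtype.range_coe]) hι (g ∘ Sum.inr)
  rw [Sum.elim_comp_inl_inr] at hc
  exact ⟨c, realizesAverage_iff.2 fun φ => (hc φ).symm.trans (hlos φ)⟩

end Average

/-! ### Invariance -/

section Invariance

variable {L : FirstOrder.Language.{u, v}} {U : Type w} [L.Structure U] {n : ℕ}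
  {A B : Set U} {D : Set (Fin n → U)}

theorem mem_image_comp_iff (f : U ≃[L] U) {c : Fin n → U} :
    c ∈ (fun c : Fin n → U => f ∘ c) '' D ↔ f.symm ∘ c ∈ D := by
  constructor
  · rintro ⟨c, hc, rfl⟩
    simpa [Function.comp_def] using hc
  · exact fun hc => ⟨_, hc, funext fun i => f.apply_symm_apply (c i)⟩

theorem isInvariant_iff : IsInvariant L A D ↔
    ∀ f : U ≃[L] U, (∀ a ∈ A, f a = a) → ∀ c : Fin n → U, f ∘ c ∈ D ↔ c ∈ D := by
  constructor
  · intro h f hf c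
    have hD : (fun c : Fin n → U => f ∘ c) '' D = D := h.le ⟨f, hf, rfl⟩
    conv_lhs => rw [← hD]
    exact f.injective.comp_left.mem_set_image
  · intro h
    refine eq_singleton_iff_unique_mem.2 ⟨⟨Language.Equiv.refl L U, fun _ _ => rfl, image_id D⟩, ?_⟩
    rintro _ ⟨f, hf, rfl⟩
    ext c
    rw [mem_image_comp_iff, ← h f hf]
    simp [Function.comp_def]

theorem IsInvariant.image (h : IsInvariant L B D) (g : U ≃[L] U) :
    IsInvariant L (g '' B) ((fun c : Fin n → U => g ∘ c) '' D) := by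
  refine isInvariant_iff.2 fun f hf c => ?_
  have hconj := isInvariant_iff.1 h ((g.symm.comp f).comp g)
    (fun b hb => by simp [hf _ (mem_image_of_mem g hb)]) (g.symm ∘ c)
  rw [mem_image_comp_iff, mem_image_comp_iff, ← hconj]
  simp [Function.comp_def]

theorem exists_elementarySubstructure_range {M : Type*} [L.Structure M] (F : M ↪ₑ[L] U) :
    ∃ N : L.ElementarySubstructure U, (N : Set U) = range F := by
  let e := F.toEmbedding.equivRange
  refine ⟨⟨F.toEmbedding.toHom.range, fun k φ y => ?_⟩, F.toEmbedding.toHom.range_coe⟩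
  have hy : e ∘ (e.symm ∘ y) = y := funext fun i => e.apply_symm_apply _
  have hy' : ((↑) : _ → U) ∘ y = F ∘ (e.symm ∘ y) := by
    conv_lhs => rw [← hy]
    rfl
  rw [hy', F.map_formula, ← StrongHomClass.realize_formula e, hy]

theorem IsLascarInvariant.isInvariant_of_mem_orbit (h : IsLascarInvariant L A D)
    {M : L.ElementarySubstructure U} (hM : #M < #U) (hAM : A ⊆ (M : Set U))
    {C : Set (Fin n → U)} (hC : C ∈ orbit L A D) : IsInvariant L (M : Set U) C := by
  obtain ⟨g, hg, rfl⟩ := hC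
  obtain ⟨N, hN⟩ := exists_elementarySubstructure_range
    (g.symm.toElementaryEmbedding.comp M.subtype)
  replace hN : (N : Set U) = g.symm '' M := by
    rw [hN, image_eq_range]
    rfl
  have hcard : #N < #U := (Cardinal.mk_congr (Equiv.setCongr hN)).trans_lt
    (Cardinal.mk_image_le.trans_lt hM)
  have hAN : A ⊆ (N : Set U) := fun a ha => by
    rw [hN]
    exact ⟨a, hAM ha, g.injective (by rw [g.apply_symm_apply, hg a ha])⟩
  simpa [hN, image_image] using (h N hcard hAN).image g

end Invariance

/-! ### Counting invariant sets -/

section Counting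

theorem mk_formula_le (L : FirstOrder.Language.{u, v}) (α : Type w) :
    #(L.Formula α) ≤ max ℵ₀ (Cardinal.lift.{max u v} #α + Cardinal.lift.{w} L.card) :=
  (Cardinal.mk_le_of_injective (f := fun φ : L.Formula α => (⟨0, φ⟩ : Σ k, L.BoundedFormula α k))
    fun φ ψ h => by simpa using h).trans BoundedFormula.card_le

variable {L : FirstOrder.Language.{u, v}} {U : Type w} [L.Structure U] {n : ℕ}

theorem IsSaturated.subset_of_forall_exists_sameType (hU : IsSaturated L U) (hκ : ℵ₀ ≤ #U)
    {A : Set U} (hA : #A < #U) {C C' : Set (Fin n → U)} (hC' : IsInvariant L A C')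
    (h : ∀ c ∈ C, ∃ c' ∈ C', SameType L[[A]] c' c) : C ⊆ C' := by
  intro c hc
  obtain ⟨c', hc', hcc'⟩ := h c hc
  obtain ⟨f, hf, rfl⟩ := hU.exists_equiv_fixing hκ hA hcc'
  exact (isInvariant_iff.1 hC' f hf c').2 hc'

theorem IsSaturated.injOn_image_type (hU : IsSaturated L U) (hκ : ℵ₀ ≤ #U) {A : Set U}
    (hA : #A < #U) :
    InjOn (fun C => (fun c : Fin n → U => {φ : L[[A]].Formula (Fin n) | φ.Realize c}) '' C)
      {C | IsInvariant L A C} := by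
  have hsub {C C' : Set (Fin n → U)} (hC' : IsInvariant L A C')
      (h : (fun c => {φ : L[[A]].Formula (Fin n) | φ.Realize c}) '' C ⊆
        (fun c => {φ : L[[A]].Formula (Fin n) | φ.Realize c}) '' C') : C ⊆ C' :=
    hU.subset_of_forall_exists_sameType hκ hA hC' fun c hc => by
      obtain ⟨c', hc', hcc'⟩ := h ⟨c, hc, rfl⟩
      exact ⟨c', hc', fun φ => Set.ext_iff.1 hcc' φ⟩
  exact fun C hC C' hC' h => (hsub hC' h.le).antisymm (hsub hC h.ge)

theorem IsSaturated.mk_setOf_isInvariant_lt (hU : IsSaturated L U) (hκ₀ : ℵ₀ < #U)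
    (hκ : (#U).IsStrongPrelimit)
    (hL : Cardinal.lift.{w} L.card < Cardinal.lift.{max u v} #U) {A : Set U} (hA : #A < #U) :
    #{C : Set (Fin n → U) | IsInvariant L A C} < #U := by
  have hformula : #(L[[A]].Formula (Fin n)) < Cardinal.lift.{max u v} #U := by
    have hκ' : ℵ₀ < Cardinal.lift.{max u v} #U := by simpa using hκ₀
    refine (mk_formula_le _ _).trans_lt (max_lt hκ' (Cardinal.add_lt_of_lt hκ'.le ?_ ?_))
    · simpa using Cardinal.natCast_lt_aleph0.trans hκ'
    · simpa [Language.card_withConstants] using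
        Cardinal.add_lt_of_lt hκ'.le hL (by simpa using hA)
  obtain ⟨μ, hμ, hμΦ⟩ := Cardinal.lt_lift_iff.1 hformula
  rw [← Cardinal.lift_lt.{w, max u v w}]
  refine (Cardinal.lift_mk_le_lift_mk_of_injective
    (hU.injOn_image_type hκ₀.le hA).injective).trans_lt ?_
  rw [Cardinal.mk_set, Cardinal.mk_set, ← hμΦ, ← Cardinal.lift_two_power, ← Cardinal.lift_two_power,
    Cardinal.lift_lift]
  exact Cardinal.lift_lt.2 (hκ (hκ hμ))

end Counting

/-! ### Indiscernible sequences and small orbits -/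

section Indiscernible

variable {L : FirstOrder.Language.{u, v}} {U : Type w} [L.Structure U] {m n : ℕ} {A : Set U}
  {D : Set (Fin n → U)}

/-- The truth value of a formula of `L(A; D)`, where the predicate is interpreted as `D`. Unlike
`Formula.Realize` it takes `D` as an argument, so that a formula can be evaluated at all the sets of
an orbit. -/
def RealizeWith (D : Set (Fin n → U)) {α : Type*}
    (φ : ((L[[A]]).sum (predicateLanguage n)).Formula α) (e : α → U) : Prop :=
  letI := predicateStructure D
  φ.Realize e

theorem realizeWith_image_comp (f : U ≃[L] U) (hf : ∀ a ∈ A, f a = a) {α : Type*}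
    (φ : ((L[[A]]).sum (predicateLanguage n)).Formula α) (e : α → U) :
    RealizeWith ((fun c : Fin n → U => f ∘ c) '' D) φ (f ∘ e) ↔ RealizeWith D φ e := by
  have hmem (c : Fin n → U) : f ∘ c ∈ (fun c : Fin n → U => f ∘ c) '' D ↔ c ∈ D :=
    f.injective.comp_left.mem_set_image
  let S := @Language.sumStructure (L[[A]]) (predicateLanguage n) U _ (predicateStructure D)
  let S' := @Language.sumStructure (L[[A]]) (predicateLanguage n) U _
    (predicateStructure ((fun c : Fin n → U => f ∘ c) '' D))
  let g : @Language.Equiv ((L[[A]]).sum (predicateLanguage n)) U U S S' :=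
    @Language.Equiv.mk _ U U S S' f.toEquiv
      (by
        rintro k ((F | a) | F) e
        · exact f.map_fun F e
        · cases k with
          | zero => exact hf _ a.2
          | succ k => exact isEmptyElim a
        · exact F.elim)
      (by
        rintro k ((R | R) | R) e
        · exact f.map_rel R e
        · exact isEmptyElim R
        · cases R
          exact hmem e)
  exact @StrongHomClass.realize_formula _ U U S S' α _ _ _ g φ e

theorem strictMono_append {I : Type*} [Preorder I] {k l : ℕ} {i : Fin k → I} {j : Fin l → I}
    (hi : StrictMono i) (hj : StrictMono j) (hij : ∀ r s, i r < j s) :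
    StrictMono (Fin.append i j) := by
  intro r s hrs
  induction r using Fin.addCases with
  | left r =>
    induction s using Fin.addCases with
    | left s => simpa using hi (show r < s from hrs)
    | right s => simpa using hij r s
  | right r =>
    induction s using Fin.addCases with
    | left s =>
      simp only [Fin.lt_def, Fin.val_natAdd, Fin.val_castAdd] at hrs
      omega
    | right s => simpa using hj ((Fin.natAdd_lt_natAdd_iff k).1 hrs)

variable {I : Type x} [LinearOrder I]

theorem IsIndiscernible.sameType_sumElim {c : I → Fin m → U} (hc : IsIndiscernible L c) {k l : ℕ}
    {i i' : Fin k → I} {j j' : Fin l → I} (hi : StrictMono i) (hj : StrictMono j)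
    (hij : ∀ r s, i r < j s) (hi' : StrictMono i') (hj' : StrictMono j')
    (hij' : ∀ r s, i' r < j' s) :
    SameType L
      (Sum.elim (fun p : Fin k × Fin m => c (i p.1) p.2) fun p : Fin l × Fin m => c (j p.1) p.2)
      (Sum.elim (fun p => c (i' p.1) p.2) fun p => c (j' p.1) p.2) := by
  have happend : SameType L (fun p : Fin (k + l) × Fin m => c (Fin.append i j p.1) p.2)
      fun p => c (Fin.append i' j' p.1) p.2 :=
    hc _ _ _ (strictMono_append hi hj hij) (strictMono_append hi' hj' hij')
  convert happend.comp (Sum.elim (Prod.map (Fin.castAdd l) id) (Prod.map (Fin.natAdd k) id))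
    using 1 <;> ext (p | p) <;> simp

theorem exists_strictMono_forall_lt [NoMaxOrder I] [Nonempty I] {s : Set I} (hs : s.Finite)
    (k : ℕ) : ∃ l : Fin k → I, StrictMono l ∧ ∀ i ∈ s, ∀ p, i < l p := by
  obtain ⟨b, hb⟩ := hs.bddAbove
  obtain ⟨b', hbb'⟩ := exists_gt b
  obtain ⟨f, hf, rfl⟩ := Nat.exists_strictMono' b'
  exact ⟨fun p => f p, hf.comp Fin.val_strictMono, fun i hi p =>
    ((hb hi).trans_lt hbb').trans_le (hf.monotone (Nat.zero_le p))⟩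

theorem exists_strictMono_blocks (I : Type*) [LinearOrder I] [NoMaxOrder I] [Nonempty I] (k : ℕ) :
    ∃ l : ℕ → Fin k → I, (∀ r, StrictMono (l r)) ∧ ∀ r s, r < s → ∀ p q, l r p < l s q :=
  exists_seq_of_forall_finset_exists StrictMono (fun l l' => ∀ p q, l p < l' q) fun F _ => by
    obtain ⟨l, hl, hlt⟩ := exists_strictMono_forall_lt
      (F.finite_toSet.biUnion fun l _ => finite_range l) k
    exact ⟨l, hl, fun l' hl' p q => hlt _ (mem_biUnion hl' (mem_range_self p)) q⟩

theorem exists_lt_forall_iff_of_two_power_lt {X : Type w} {W : Type w} [LinearOrder W]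
    (hXW : 2 ^ #X < #W) (p : W → X → Prop) : ∃ s t, s < t ∧ ∀ x, p s x ↔ p t x := by
  have hp : ¬ Function.Injective p := fun hp =>
    ((Cardinal.mk_le_of_injective hp).trans_eq Cardinal.mk_set).not_gt hXW
  obtain ⟨s, t, hst, hne⟩ := Function.not_injective_iff.1 hp
  rcases hne.lt_or_gt with h | h
  exacts [⟨s, t, h, fun x => iff_of_eq (congrFun hst x)⟩,
    ⟨t, s, h, fun x => iff_of_eq (congrFun hst x).symm⟩]

theorem IsSaturated.exists_pairwise_sameType (hU : IsSaturated L U) (hκ : ℵ₀ ≤ #U)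
    (hA : #A < #U) {ι : Type x} [Finite ι] {a b : ι → U} {d : ℕ → ι → U}
    (hd : ∀ r s, r < s → SameType L[[A]] (Sum.elim a b) (Sum.elim (d r) (d s)))
    {W : Type w} [LinearOrder W] (hW : #W ≤ #U) :
    ∃ e : W → ι → U, ∀ s t, s < t → SameType L[[A]] (Sum.elim a b) (Sum.elim (e s) (e t)) := by
  classical
  have hι : Cardinal.lift.{w} #(W × ι) ≤ Cardinal.lift.{max w x} #U := by
    have hκ' : ℵ₀ ≤ Cardinal.lift.{max w x} #U := Cardinal.aleph0_le_lift.2 hκ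
    rw [Cardinal.mk_prod, Cardinal.lift_mul, Cardinal.lift_lift, Cardinal.lift_lift]
    exact Cardinal.mul_le_of_le hκ' (Cardinal.lift_le.2 hW)
      ((Cardinal.lift_lt_aleph0.2 (Cardinal.mk_lt_aleph0 (α := ι))).le.trans hκ')
  -- `e s` is the limit over finite `F ⊆ W` of `d r`, where `r` is the position of `s` in `F`.
  obtain ⟨𝒱, h𝒱⟩ := Ultrafilter.exists_le (atTop : Filter (Finset W))
  obtain ⟨e, he⟩ := hU.exists_realizesAverage hκ hA hι 𝒱
    fun (F : Finset W) (p : W × ι) => d (F.filter (· < p.1)).card p.2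
  refine ⟨fun s i => e (s, i), fun s t hst φ => ?_⟩
  have hcard (F : Finset W) (hF : {s} ≤ F) : (F.filter (· < s)).card < (F.filter (· < t)).card := by
    refine Finset.card_lt_card (Finset.ssubset_iff_of_subset ?_ |>.2 ⟨s, ?_, by simp⟩)
    · exact Finset.monotone_filter_right F fun z _ hzs => hzs.trans hst
    · exact Finset.mem_filter.2 ⟨Finset.singleton_subset_iff.1 hF, hst⟩
  have hφ := he (φ.relabel (Sum.elim (fun i => (s, i)) fun i => (t, i)))
  simp only [Formula.realize_relabel, Sum.comp_elim] at hφ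
  have hev : ∀ᶠ F : Finset W in 𝒱, φ.Realize (Sum.elim a b) ↔ φ.Realize
      (Sum.elim (d (F.filter (· < s)).card) (d (F.filter (· < t)).card)) := by
    filter_upwards [h𝒱 (eventually_ge_atTop {s})] with F hF
    exact hd _ _ (hcard F hF) φ
  exact eventually_const.symm.trans ((eventually_congr hev).trans hφ.symm)

theorem IsSaturated.realizeWith_iff_of_mk_orbit_lt (hU : IsSaturated L U) (hκ₀ : ℵ₀ ≤ #U)
    (hκ : (#U).IsStrongPrelimit) (hA : #A < #U) (hD : #(orbit L A D) < #U) {ι : Type*} [Finite ι]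
    {a b : ι → U} {d : ℕ → ι → U}
    (hd : ∀ r s, r < s → SameType L[[A]] (Sum.elim a b) (Sum.elim (d r) (d s)))
    (φ : ((L[[A]]).sum (predicateLanguage n)).Formula ι) :
    RealizeWith D φ a ↔ RealizeWith D φ b := by
  obtain ⟨_, _, -⟩ := Cardinal.exists_ord_eq_type_lt U
  obtain ⟨e, he⟩ := hU.exists_pairwise_sameType hκ₀ hA hd (W := U) le_rfl
  obtain ⟨s, t, hst, hφ⟩ := exists_lt_forall_iff_of_two_power_lt (hκ hD)
    fun s (C : orbit L A D) => RealizeWith C.1 φ (e s)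
  obtain ⟨f, hf, hfe⟩ := hU.exists_equiv_fixing hκ₀ hA (he s t hst)
  have hfa : f ∘ a = e s := funext fun i => congrFun hfe (Sum.inl i)
  have hfb : f ∘ b = e t := funext fun i => congrFun hfe (Sum.inr i)
  rw [← realizeWith_image_comp f hf φ a, ← realizeWith_image_comp f hf φ b, hfa, hfb]
  exact hφ ⟨_, f, hf, rfl⟩

theorem IsSaturated.isIndiscernibleOverWith_of_mk_orbit_lt (hU : IsSaturated L U) (hκ₀ : ℵ₀ ≤ #U)
    (hκ : (#U).IsStrongPrelimit) (hA : #A < #U) (hD : #(orbit L A D) < #U) [NoMaxOrder I]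
    {c : I → Fin m → U} (hc : IsIndiscernibleOver L A c) : IsIndiscernibleOverWith L A D c := by
  intro k i j hi hj φ
  rcases isEmpty_or_nonempty I with _ | _
  · rw [Subsingleton.elim i j]
  have hblock {i l : Fin k → I} (hi : StrictMono i) (hl : StrictMono l) (hil : ∀ p q, i p < l q) :
      RealizeWith D φ (fun p => c (i p.1) p.2) ↔ RealizeWith D φ (fun p => c (l p.1) p.2) := by
    obtain ⟨b, hb, hlt⟩ := exists_strictMono_blocks I k
    exact hU.realizeWith_iff_of_mk_orbit_lt hκ₀ hκ hA hD (d := fun r p => c (b r p.1) p.2)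
      (fun r s hrs => IsIndiscernible.sameType_sumElim hc hi hl hil (hb r) (hb s) (hlt r s hrs)) φ
  obtain ⟨l, hl, hlt⟩ := exists_strictMono_forall_lt ((finite_range i).union (finite_range j)) k
  exact (hblock hi hl fun p => hlt _ (Or.inl ⟨p, rfl⟩)).trans
    (hblock hj hl fun p => hlt _ (Or.inr ⟨p, rfl⟩)).symm

end Indiscernible

/-! ### Coheir sequences -/

section Coheir

variable {L : FirstOrder.Language.{u, v}} {U : Type w} [L.Structure U] {n : ℕ} {A B : Set U}

theorem exists_realize_elementarySubstructure {N : L.ElementarySubstructure U} {ι : Type*}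
    [Finite ι] {φ : L.Formula (N ⊕ ι)} {a : ι → U} (h : φ.Realize (Sum.elim ((↑) : N → U) a)) :
    ∃ y : ι → N, φ.Realize (Sum.elim ((↑) : N → U) fun i => (y i : U)) := by
  have hU : (φ.iExs ι).Realize ((↑) : N → U) := Formula.realize_iExs.2 ⟨a, h⟩
  obtain ⟨y, hy⟩ := Formula.realize_iExs.1 ((N.subtype.map_formula (φ.iExs ι) id).1 hU)
  have hφ := (N.subtype.map_formula φ _).2 hy
  rw [Sum.comp_elim] at hφ
  exact ⟨y, hφ⟩

theorem exists_realizesAverage_elementarySubstructure (N : L.ElementarySubstructure U) {ι : Type*}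
    [Finite ι] (a : ι → U) : ∃ 𝒱 : Ultrafilter (ι → N),
      RealizesAverage L 𝒱 (fun y i => (y i : U)) (N : Set U) a := by
  let p := {φ : L.Formula (N ⊕ ι) // φ.Realize (Sum.elim ((↑) : N → U) a)}
  let s (φ : p) : Set (ι → N) := {y | φ.1.Realize (Sum.elim ((↑) : N → U) fun i => (y i : U))}
  have : Nonempty p := ⟨⟨⊤, Formula.realize_top.2 trivial⟩⟩
  have hdir : Directed (· ≥ ·) fun φ => 𝓟 (s φ) := fun φ ψ =>
    ⟨⟨φ.1 ⊓ ψ.1, Formula.realize_inf.2 ⟨φ.2, ψ.2⟩⟩,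
      principal_mono.2 fun _ hy => (Formula.realize_inf.1 hy).1,
      principal_mono.2 fun _ hy => (Formula.realize_inf.1 hy).2⟩
  have : NeBot (⨅ φ, 𝓟 (s φ)) := iInf_neBot_of_directed' hdir fun φ =>
    principal_neBot_iff.2 (exists_realize_elementarySubstructure φ.2)
  obtain ⟨𝒱, h𝒱⟩ := Ultrafilter.exists_le (⨅ φ, 𝓟 (s φ))
  have hmem (φ : L.Formula (N ⊕ ι)) (hφ : φ.Realize (Sum.elim ((↑) : N → U) a)) :
      ∀ᶠ y : ι → N in 𝒱, φ.Realize (Sum.elim ((↑) : N → U) fun i => (y i : U)) :=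
    h𝒱 (mem_iInf_of_mem ⟨φ, hφ⟩ (mem_principal_self _))
  refine ⟨𝒱, realizesAverage_iff.2 fun φ => ⟨hmem φ, fun h => by_contra fun hn => ?_⟩⟩
  exact Ultrafilter.eventually_not.1 (hmem φ.not hn) h

variable {Y ι : Type*} {𝒱 : Ultrafilter Y}

theorem RealizesAverage.sameType_sumElim {e : Y → ι → U} {B' : Set U} {c c' : ι → U}
    (hc : RealizesAverage L 𝒱 e B c) (hc' : RealizesAverage L 𝒱 e B' c') {β : Type*} {d d' : β → U}
    (hd : ∀ i, d i ∈ B) (hd' : ∀ i, d' i ∈ B')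
    (h : ∀ y, SameType L (Sum.elim d (e y)) (Sum.elim d' (e y))) :
    SameType L (Sum.elim d c) (Sum.elim d' c') := fun φ => by
  rw [hc.realize_iff hd, hc'.realize_iff hd']
  exact eventually_congr (.of_forall fun y => h y φ)

theorem isIndiscernibleOver_of_realizesAverage {I : Type x} [LinearOrder I] {e : Y → Fin n → U}
    (he : ∀ y r, e y r ∈ A) {c : I → Fin n → U}
    (hc : ∀ i, RealizesAverage L 𝒱 e (A ∪ ⋃ j ∈ Iio i, range (c j)) (c i)) :
    IsIndiscernibleOver L A c := by
  suffices h : ∀ k (i j : Fin k → I), StrictMono i → StrictMono j →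
      SameType L (Sum.elim ((↑) : A → U) fun p : Fin k × Fin n => c (i p.1) p.2)
        (Sum.elim (↑) fun p => c (j p.1) p.2) from
    fun k i j hi hj => sameType_withConstants_iff.2 (h k i j hi hj)
  intro k
  induction k with
  | zero =>
    intro i j _ _ φ
    rw [Subsingleton.elim i j]
  | succ k ih =>
    intro i j hi hj
    have hprev {i : Fin (k + 1) → I} (hi : StrictMono i) : ∀ q,
        Sum.elim ((↑) : A → U) (fun p : Fin k × Fin n => c (i p.1.castSucc) p.2) q ∈
          A ∪ ⋃ j ∈ Iio (i (Fin.last k)), range (c j)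
      | Sum.inl a => Or.inl a.2
      | Sum.inr p => Or.inr (mem_biUnion (hi (Fin.castSucc_lt_last p.1)) (mem_range_self p.2))
    have hlast := (hc _).sameType_sumElim (hc _) (hprev hi) (hprev hj) fun y => by
      convert (ih _ _ (hi.comp Fin.strictMono_castSucc) (hj.comp Fin.strictMono_castSucc)).comp
        (Sum.elim id fun r => Sum.inl ⟨e y r, he y r⟩) using 1 <;> ext (q | r) <;> rfl
    convert hlast.comp (Sum.elim (Sum.inl ∘ Sum.inl) fun p : Fin (k + 1) × Fin n =>
        Fin.lastCases (Sum.inr p.2) (fun q => Sum.inl (Sum.inr (q, p.2))) p.1) using 1 <;>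
      ext (a | ⟨p, r⟩) <;> [rfl; skip; rfl; skip] <;> induction p using Fin.lastCases <;> simp

theorem IsSaturated.exists_seq_realizesAverage (hU : IsSaturated L U) (hκ : ℵ₀ ≤ #U)
    (hB : #B < #U) [Finite ι] {Y : Type w} (𝒱 : Ultrafilter Y) (e : Y → ι → U) :
    ∃ c : ℕ → ι → U, ∀ k, RealizesAverage L 𝒱 e (B ∪ ⋃ j ∈ Iio k, range (c j)) (c k) := by
  have hι : Cardinal.lift.{w} #ι ≤ Cardinal.lift #U :=
    (Cardinal.lift_lt_aleph0.2 Cardinal.mk_lt_aleph0).le.trans (Cardinal.aleph0_le_lift.2 hκ)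
  have : Nonempty (ι → U) := (hU.exists_realizesAverage hκ hB hι 𝒱 e).nonempty
  obtain ⟨c, hc⟩ := exists_forall_image_Iio fun (_ : ℕ) S x =>
    RealizesAverage L 𝒱 e (B ∪ ⋃ y ∈ S, range y) x
  refine ⟨c, fun k => ?_⟩
  have hfin : (⋃ y ∈ c '' Iio k, range y).Finite :=
    ((finite_Iio k).image c).biUnion fun y _ => finite_range y
  simpa only [biUnion_image] using
    hc k (hU.exists_realizesAverage hκ (mk_union_lt_of_finite hκ hB hfin) hι 𝒱 e)

theorem IsSaturated.exists_isIndiscernibleOver_common_tail (hU : IsSaturated L U) (hκ : ℵ₀ ≤ #U)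
    (hA : #A < #U) {Y : Type w} {𝒱 : Ultrafilter Y} {e : Y → Fin n → U} (he : ∀ y r, e y r ∈ A)
    {a b : Fin n → U} (ha : RealizesAverage L 𝒱 e A a) (hb : RealizesAverage L 𝒱 e A b) :
    ∃ c d : ℕ → Fin n → U, IsIndiscernibleOver L A c ∧ IsIndiscernibleOver L A d ∧
      c 0 = a ∧ d 0 = b ∧ ∀ k, c (k + 1) = d (k + 1) := by
  obtain ⟨t, ht⟩ := hU.exists_seq_realizesAverage hκ
    (mk_union_lt_of_finite hκ hA ((finite_range a).union (finite_range b))) 𝒱 e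
  have hcons {x : Fin n → U} (hx : RealizesAverage L 𝒱 e A x)
      (hxab : range x ⊆ range a ∪ range b) :
      IsIndiscernibleOver L A fun k : ℕ => (Nat.casesOn k x t : Fin n → U) := by
    refine isIndiscernibleOver_of_realizesAverage (𝒱 := 𝒱) he fun k => ?_
    cases k with
    | zero => exact hx.mono (by simp)
    | succ k =>
      refine (ht k).mono (union_subset (subset_union_left.trans subset_union_left)
        (iUnion₂_subset fun j hj => ?_))
      cases j with
      | zero => exact (hxab.trans subset_union_right).trans subset_union_left
      | succ j =>
        have hjk : j ∈ Iio k := Nat.lt_of_succ_lt_succ hj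
        exact (subset_biUnion_of_mem (u := fun j => range (t j)) hjk).trans subset_union_right
  exact ⟨_, _, hcons ha subset_union_left, hcons hb subset_union_right, rfl, rfl, fun _ => rfl⟩

theorem sameType_comp_of_fixing {f : U ≃[L] U} (hf : ∀ x ∈ A, f x = x) (a : ι → U) :
    SameType L[[A]] a (f ∘ a) := sameType_withConstants_iff.2 fun φ => by
  have hfA : ((↑) : A → U) = f ∘ (↑) := funext fun x => (hf x x.2).symm
  rw [← StrongHomClass.realize_formula f φ (v := Sum.elim (↑) a), Sum.comp_elim, ← hfA]

theorem IsIndiscernibleOver.mono {I : Type x} [LinearOrder I] (hAB : A ⊆ B) {m : ℕ}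
    {c : I → Fin m → U} (hc : IsIndiscernibleOver L B c) : IsIndiscernibleOver L A c :=
  fun k i j hi hj => SameType.withConstants_mono hAB (hc k i j hi hj)

theorem IsSaturated.isLascarInvariant_of_isIndiscernibleOver (hU : IsSaturated L U) (hκ : ℵ₀ ≤ #U)
    {D : Set (Fin n → U)}
    (h : ∀ c : ℕ → Fin n → U, IsIndiscernibleOver L A c → (c 0 ∈ D ↔ c 1 ∈ D)) :
    IsLascarInvariant L A D := by
  refine fun N hN hAN => isInvariant_iff.2 fun f hf a => ?_
  obtain ⟨𝒱, ha⟩ := exists_realizesAverage_elementarySubstructure N a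
  have hfa : RealizesAverage L 𝒱 (fun y i => (y i : U)) (N : Set U) (f ∘ a) := fun φ =>
    (sameType_comp_of_fixing hf a φ).symm.trans (ha φ)
  obtain ⟨c, d, hc, hd, rfl, hda, hcd⟩ :=
    hU.exists_isIndiscernibleOver_common_tail hκ hN (fun y r => (y r).2) ha hfa
  rw [← hda, h c (hc.mono hAN), h d (hd.mono hAN), hcd]

end Coheir

/-! ### Restrictions of indiscernible sequences -/

section Sequences

variable {L : FirstOrder.Language.{u, v}} {U : Type w} [L.Structure U] {n : ℕ} {A : Set U}
  {I : Type x} [LinearOrder I]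

theorem mem_iff_mem_of_isIndiscernibleOverWith {D : Set (Fin n → U)} {c : I → Fin n → U}
    (hc : IsIndiscernibleOverWith L A D c) (i j : I) : c i ∈ D ↔ c j ∈ D :=
  hc 1 (fun _ => i) (fun _ => j) (Subsingleton.strictMono _) (Subsingleton.strictMono _)
    (Relations.formula (Sum.inr PredicateSymbol.mem) fun r => Term.var (0, r))

theorem IsIndiscernibleOver.comp_strictMono {m : ℕ} {J : Type*} [LinearOrder J]
    {c : I → Fin m → U} (hc : IsIndiscernibleOver L A c) {g : J → I} (hg : StrictMono g) :
    IsIndiscernibleOver L A (c ∘ g) :=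
  fun k i j hi hj => hc k (g ∘ i) (g ∘ j) (hg.comp hi) (hg.comp hj)

theorem mem_iff_mem_of_forall_isIndiscernibleOverWith {D : Set (Fin n → U)}
    (h : ∀ (I : Type x) [LinearOrder I] [NoMaxOrder I] (m : ℕ) (c : I → Fin m → U),
      IsIndiscernibleOver L A c → IsIndiscernibleOverWith L A D c)
    {c : ℕ → Fin n → U} (hc : IsIndiscernibleOver L A c) (i j : ℕ) : c i ∈ D ↔ c j ∈ D :=
  have : NoMaxOrder (ULift.{x} ℕ) := ⟨fun k => ⟨⟨k.down + 1⟩, Nat.lt_succ_self k.down⟩⟩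
  mem_iff_mem_of_isIndiscernibleOverWith (h (ULift.{x} ℕ) n (c ∘ ULift.down)
    (hc.comp_strictMono fun _ _ hij => hij)) ⟨i⟩ ⟨j⟩

end Sequences

end LascarInvariance

theorem mainTheorem5_general (L : FirstOrder.Language.{u, v}) (U : Type w) [L.Structure U]
    (hU : LascarInvariance.IsSaturated L U) (hκ₀ : ℵ₀ < #U) (hκ : (#U).IsStrongPrelimit)
    (hL : Cardinal.lift.{w} L.card < Cardinal.lift.{max u v} #U)
    (n : ℕ) (D : Set (Fin n → U))
    (A : Set U) (M : L.ElementarySubstructure U) (hM : #M < #U) (hAM : A ⊆ (M : Set U)) :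
    List.TFAE [
      LascarInvariance.IsLascarInvariant L A D,
      ∀ C ∈ LascarInvariance.orbit L A D, LascarInvariance.IsInvariant L (M : Set U) C,
      #(LascarInvariance.orbit L A D) < #U,
      ∀ (I : Type x) [LinearOrder I] [NoMaxOrder I] (m : ℕ) (c : I → Fin m → U),
        LascarInvariance.IsIndiscernibleOver L A c →
          LascarInvariance.IsIndiscernibleOverWith L A D c,
      ∀ c : ℕ → Fin n → U, LascarInvariance.IsIndiscernibleOver L A c → (c 0 ∈ D ↔ c 1 ∈ D)] := by
  have hA : #A < #U := (Cardinal.mk_le_mk_of_subset hAM).trans_lt hM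
  tfae_have 1 → 2 := fun h C hC => h.isInvariant_of_mem_orbit hM hAM hC
  tfae_have 2 → 3 := fun h => (Cardinal.mk_le_mk_of_subset h).trans_lt
    (hU.mk_setOf_isInvariant_lt hκ₀ hκ hL hM)
  tfae_have 3 → 4 := fun h I _ _ m c hc =>
    hU.isIndiscernibleOverWith_of_mk_orbit_lt hκ₀.le hκ hA h hc
  tfae_have 4 → 5 := fun h c hc =>
    LascarInvariance.mem_iff_mem_of_forall_isIndiscernibleOverWith h hc 0 1
  tfae_have 5 → 1 := fun h => hU.isLascarInvariant_of_isIndiscernibleOver hκ₀.le h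
  tfae_finish

theorem mainTheorem5 (L : FirstOrder.Language.{u, v}) (U : Type w) [L.Structure U]
    (hU : LascarInvariance.IsSaturated L U) (hκ : (#U).IsInaccessible)
    (hL : Cardinal.lift.{w} L.card < Cardinal.lift.{max u v} #U)
    (n : ℕ) (D : Set (Fin n → U))
    (A : Set U) (M : L.ElementarySubstructure U) (hM : #M < #U) (hAM : A ⊆ (M : Set U)) :
    List.TFAE [
      LascarInvariance.IsLascarInvariant L A D,
      ∀ C ∈ LascarInvariance.orbit L A D, LascarInvariance.IsInvariant L (M : Set U) C,
      #(LascarInvariance.orbit L A D) < #U,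
      ∀ (I : Type x) [LinearOrder I] [NoMaxOrder I] (m : ℕ) (c : I → Fin m → U),
        LascarInvariance.IsIndiscernibleOver L A c →
          LascarInvariance.IsIndiscernibleOverWith L A D c,
      ∀ c : ℕ → Fin n → U, LascarInvariance.IsIndiscernibleOver L A c → (c 0 ∈ D ↔ c 1 ∈ D)] :=
  mainTheorem5_general L U hU hκ.aleph0_lt hκ.isStrongPrelimit hL n D A M hM hAM
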